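/- **Notation.** For a partition $\lambda=(\lambda_1\ge\dots\ge\lambda_r)$ of $n\ge1$ put $l(\lambda)=r$, $n(\lambda)=\sum_{i}(i-1)\lambda_i$, and $m(\lambda)!=\prod_j r_j!$, where $r_j$ is the number of parts of $\lambda$ equal to $j$. Consider the specialization of symmetric functions (over $\mathbb{Q}$, with values in $\mathbb{Q}[q]$) that sends the elementary symmetric function $e_k$ to $q^{\binom k2}/k!$ for $k\ge1$, and let $[m_\lambda]$ be the image of the monomial symmetric function $m_\lambda$. The polynomial $J_\lambda(q)$ is the quotient determined by $$(n-1)!\,m(\lambda)!\,[m_\lambda]=(1-q)^{\,n-l(\lambda)}\,q^{\,n(\lambda)}\,J_\lambda(q),\tag{1}$$ and $$P_\lambda(t)=n\,t^n\,\frac{(1+t)^{n(\lambda)}}{m(\lambda)!}\,J_\lambda(1+t).$$ Let $K_{n+1}$ be the complete graph on $\{1,\dots,n+1\}$ with root $1$, and let $\mathcal P_n^{(s)}$ be the set of spanning connected subgraphs $C$ of $K_{n+1}$ in which the root has degree $s$. The depth-first search of such a $C$ starts at $1$ and at each step goes to the greatest unvisited vertex adjacent to the current vertex if there is one, and otherwise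 backtracks. Let $w(C)$ be the word formed by the vertices other than $1$ in the order in which they are first visited. Cut $w(C)$ in front of every letter that is adjacent to $1$ in $C$, and let $\Lambda(C)$ be the partition of $n$ whose parts are the lengths of the resulting subwords. For a partition $\lambda$ of $n$ with $l(\lambda)=s$ let $\mathcal P_\lambda$ be the set of $C\in\mathcal P_n^{(s)}$ with $\Lambda(C)=\lambda$, and let $e(C)$ be the number of edges of $C$. **Theorem.** Let $n\ge1$ and let $\lambda$ be a partition of $n$ of one of the types $(n)$, $1^n=(1,\dots,1)$, or, for $n\ge2$, $1^{n-2}2=(2,1,\dots,1)$. Then the division in (1) is exact, so that $J_\lambda\in\mathbb{Q}[q]$ satisfies (1), and $$P_\lambda(t)=\sum_{C\in\mathcal P_\lambda}t^{e(C)} .$$ Moreover $\mathcal P_{(n)}=\mathcal P_n^{(1)}$ and $\mathcal P_{1^n}=\mathcal P_n^{(n)}$ for $n\ge1$, and $\mathcal P_{1^{n-2}2}=\mathcal P_n^{(n-1)}$ for $n\ge2$. -/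

import Mathlib

open Polynomial

/-! ### Depth-first search on graphs with vertex set `{1, …, n+1}`

The vertex `i + 1` of `K_{n+1}` is the element `i : Fin (n + 1)`, so the root `1` is `0`.
A spanning subgraph of `K_{n+1}` is a `SimpleGraph (Fin (n + 1))`. -/

/-- The sequence of vertices entered from now on by the depth-first search of `C`, when `visited`
is the set of visited vertices and the list is the path from the current vertex (its head) back to
the root: go to the greatest unvisited vertex adjacent to the current vertex if there is one,
otherwise backtrack by one vertex. The search ends when all vertices have been visited (or when
it would have to backtrack from the root); the first argument bounds the number of moves. -/
def dfsFrom {n : ℕ} (C : SimpleGraph (Fin (n + 1))) [DecidableRel C.Adj] :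
    ℕ → Finset (Fin (n + 1)) → List (Fin (n + 1)) → List (Fin (n + 1))
  | 0, _, _ => []
  | _ + 1, _, [] => []
  | k + 1, visited, v :: path =>
    if visited = Finset.univ then []
    else if h : (Finset.univ.filter fun u => C.Adj v u ∧ u ∉ visited).Nonempty then
      let u := (Finset.univ.filter fun u => C.Adj v u ∧ u ∉ visited).max' h
      u :: dfsFrom C k (insert u visited) (u :: v :: path)
    else
      match path with
      | [] => []
      | u :: rest => u :: dfsFrom C k visited (u :: rest)

/-- The sequence `τ(C)` of vertices read in the order of the depth-first search started at the
root. Each of the at most `n` edges of the search tree is used at most once in each direction, so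
that `2 * n` moves always suffice. -/
def dfsSeq {n : ℕ} (C : SimpleGraph (Fin (n + 1))) [DecidableRel C.Adj] : List (Fin (n + 1)) :=
  0 :: dfsFrom C (2 * n) {0} [0]

/-- The word `w(C)`: only the first occurrence of each letter of `τ(C)` is kept (`List.dedup`
keeps the last occurrences, whence the two reversals), and the root is deleted. -/
def dfsWord {n : ℕ} (C : SimpleGraph (Fin (n + 1))) [DecidableRel C.Adj] : List (Fin (n + 1)) :=
  (dfsSeq C).reverse.dedup.reverse.filter fun v => decide (v ≠ 0)

/-- The subwords of `w(C)` obtained by cutting `w(C)` in front of each letter adjacent to the root: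
two consecutive letters `a b` stay together exactly when `b` is not adjacent to the root. -/
def dfsSubwords {n : ℕ} (C : SimpleGraph (Fin (n + 1))) [DecidableRel C.Adj] :
    List (List (Fin (n + 1))) :=
  (dfsWord C).splitBy fun _ b => decide (¬ C.Adj 0 b)

/-- The partition `Λ(C)`, as the multiset of its parts: the lengths of the subwords. -/
def dfsParts {n : ℕ} (C : SimpleGraph (Fin (n + 1))) [DecidableRel C.Adj] : Multiset ℕ :=
  ((dfsSubwords C).map List.length : List ℕ)

noncomputable section

open Classical in
/-- `𝒫_n^{(s)}`: the spanning connected subgraphs of `K_{n+1}` in which the root has degree `s`. -/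
def rootDegreeGraphs (n s : ℕ) : Finset (SimpleGraph (Fin (n + 1))) :=
  Finset.univ.filter fun C => C.Connected ∧ C.degree 0 = s

open Classical in
/-- `𝒫_λ`: the graphs `C` in `𝒫_n^{(s)}`, with `s` the length of `λ`, such that `Λ(C) = λ`. -/
def dfsGraphs {n : ℕ} (lam : n.Partition) : Finset (SimpleGraph (Fin (n + 1))) :=
  (rootDegreeGraphs n lam.parts.card).filter fun C => dfsParts C = lam.parts

open Classical in
/-- The edge enumerator `∑_{C ∈ S} t ^ e(C)` of a set of graphs. -/
def edgeEnumerator {n : ℕ} (S : Finset (SimpleGraph (Fin (n + 1)))) : ℚ[X] :=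
  ∑ C ∈ S, X ^ C.edgeFinset.card

/-! ### The polynomials `J_λ` and `P_λ` -/

/-- `n(λ) = ∑ (i - 1) λ_i`, the parts `λ_1 ≥ λ_2 ≥ …` being in non-increasing order. -/
def partitionWeight {n : ℕ} (lam : n.Partition) : ℕ :=
  ((lam.parts.sort (· ≥ ·)).mapIdx fun i a => i * a).sum

/-- `m(λ)! = ∏_j r_j !`, where `r_j` is the number of parts of `λ` equal to `j`. -/
def multFactorial {n : ℕ} (lam : n.Partition) : ℕ :=
  ∏ j ∈ lam.parts.toFinset, (lam.parts.count j).factorial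

/-- The specialization of symmetric functions determined by `e_k ↦ q ^ (k choose 2) / k !`, that is
`∑ e_k z ^ k ↦ ∑ q ^ (k choose 2) z ^ k / k !`, on the symmetric polynomials in `n` variables
(which are freely generated by `e_1, …, e_n`). The indeterminate of `ℚ[X]` is `q`. -/
def specialization (n : ℕ) : MvPolynomial.symmetricSubalgebra (Fin n) ℚ →ₐ[ℚ] ℚ[X] :=
  (MvPolynomial.aeval fun i : Fin n =>
      C (1 / ((i.val + 1).factorial : ℚ)) * (X : ℚ[X]) ^ (i.val + 1).choose 2).comp
    (MvPolynomial.esymmAlgEquiv (R := ℚ) (σ := Fin n) (n := n) (Fintype.card_fin n)).symm.toAlgHom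

/-- The image of the monomial symmetric function `m_λ` under `specialization`. Since `λ` is a
partition of `n`, the expression of `m_λ` through the `e_k` can be read off in `n` variables. -/
def specializedMonomial {n : ℕ} (lam : n.Partition) : ℚ[X] :=
  specialization n ⟨MvPolynomial.msymm (Fin n) ℚ lam, MvPolynomial.msymm_isSymmetric _ _ lam⟩

/-- The equation
`(n-1)! m(λ)! m_λ = (1 - q) ^ (n - l(λ)) q ^ n(λ) J`
for the specialized monomial symmetric function, which characterizes `J = J_λ`. -/
def IsMonomialJ {n : ℕ} (lam : n.Partition) (J : ℚ[X]) : Prop :=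
  C (((n - 1).factorial * multFactorial lam : ℕ) : ℚ) * specializedMonomial lam =
    (1 - X) ^ (n - lam.parts.card) * X ^ partitionWeight lam * J

/-- `J_λ(q)`, as the quotient solving the equation in `IsMonomialJ`. -/
def monomialJ {n : ℕ} (lam : n.Partition) : ℚ[X] :=
  C (((n - 1).factorial * multFactorial lam : ℕ) : ℚ) * specializedMonomial lam /
    ((1 - X) ^ (n - lam.parts.card) * X ^ partitionWeight lam)

/-- `P_λ(t) = n t ^ n (1 + t) ^ n(λ) J_λ(1 + t) / m(λ)!`. -/
def polyP {n : ℕ} (lam : n.Partition) : ℚ[X] :=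
  C ((n : ℚ) / (multFactorial lam : ℚ)) * X ^ n * (1 + X) ^ partitionWeight lam *
    (monomialJ lam).comp (1 + X)

end

/-! ### The depth-first search of a connected graph -/

/-! Each of the three shapes is the only partition of `n` with its number of parts. In a connected
`C` the subwords of `w(C)` begin exactly at the neighbours of the root, so `Λ(C)` is a partition of
`n` with `deg(root)` parts. For these shapes the length therefore decides everything, the visiting
order plays no role, and `dfsGraphs` reduces to `rootDegreeGraphs`.

Deleting the root leaves a graph on `n` vertices each of whose components meets the set of former
neighbours. With `c_n(t)` the edge enumerator of connected graphs (`connEnum`), root degrees `1`,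
`n`, `n - 1` give `n t c_n(t)`, `t^n (1+t)^(n choose 2)` and `n t^(n-1) ((1+t)^(n-1) - 1)
(1+t)^((n-1) choose 2)`.

On the algebraic side, `m_(n) = p_n`, `m_(1^n) = e_n` and `m_(2,1^(n-2)) = p_1 e_(n-1) - n e_n`. The
last two specialize at once. For `p_n`, splitting off the component of a vertex
(`one_add_X_pow_choose_two`) gives a recursion for `c_n` which, at `t = q - 1`, is Newton's identity
for the specialized `e_k`. Hence `p_n` goes to `(-1)^(n-1) c_n(q-1)/(n-1)!` (`specialization_psum`).
It is divisible by `(1-q)^(n-1)` because a connected graph on `n` vertices has at least `n - 1`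
edges. -/

theorem SimpleGraph.Preconnected.eq_univ_of_adj_closed {V : Type*} [Fintype V]
    {G : SimpleGraph V} (hG : G.Preconnected) {s : Finset V} (hs : s.Nonempty)
    (h : ∀ v ∈ s, ∀ u, G.Adj v u → u ∈ s) : s = Finset.univ := by
  obtain ⟨a, ha⟩ := hs
  refine Finset.eq_univ_of_forall fun b => ?_
  obtain ⟨w⟩ := hG a b
  induction w with
  | nil => exact ha
  | cons hadj _ ih => exact ih (h _ ha _ hadj)

/-- Invariant: a visited vertex that has left the path has only visited neighbours. An unvisited
vertex costs at most two moves (entering and leaving) and a path vertex other than the root one, so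
the bound on `k` drops by one at each move. If the search is stuck at the root, the visited set is
closed under adjacency, hence everything by connectedness. -/
theorem mem_or_mem_dfsFrom {n : ℕ} (C : SimpleGraph (Fin (n + 1))) [DecidableRel C.Adj]
    (hC : C.Connected) (k : ℕ) (visited : Finset (Fin (n + 1))) (path : List (Fin (n + 1)))
    (hne : path ≠ []) (hpath : ∀ v ∈ path, v ∈ visited)
    (hclosed : ∀ v ∈ visited, v ∉ path → ∀ u, C.Adj v u → u ∈ visited)
    (hk : 2 * (n + 1 - visited.card) + (path.length - 1) ≤ k) (x : Fin (n + 1)) :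
    x ∈ visited ∨ x ∈ dfsFrom C k visited path := by
  induction k generalizing visited path with
  | zero =>
    left
    have : visited = Finset.univ := by
      rw [← Finset.card_eq_iff_eq_univ, Fintype.card_fin]
      have := Finset.card_le_univ visited
      rw [Fintype.card_fin] at this
      omega
    simp [this]
  | succ k ih =>
    match path, hne with
    | v :: path, _ =>
    rw [dfsFrom]
    split_ifs with huniv h
    · simp [huniv]
    · dsimp only
      set u := (Finset.univ.filter fun u => C.Adj v u ∧ u ∉ visited).max' h with hu
      have hmem := Finset.max'_mem _ h
      rw [← hu, Finset.mem_filter] at hmem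
      have hcard : visited.card < n + 1 := by
        have := Finset.card_lt_univ_of_notMem hmem.2.2
        rwa [Fintype.card_fin] at this
      have key := ih (insert u visited) (u :: v :: path) (by simp)
        (by
          intro w hw
          rcases List.mem_cons.1 hw with rfl | hw
          · exact Finset.mem_insert_self _ _
          · exact Finset.mem_insert_of_mem (hpath w hw))
        (by
          intro w hw hwp y hy
          rw [Finset.mem_insert] at hw ⊢
          rcases hw with rfl | hw
          · simp at hwp
          · exact Or.inr (hclosed w hw (fun h' => hwp (List.mem_cons_of_mem _ h')) y hy))
        (by
          rw [Finset.card_insert_of_notMem hmem.2.2]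
          simp only [List.length_cons] at hk ⊢
          omega)
      rw [Finset.mem_insert] at key
      rw [List.mem_cons]
      tauto
    · have hv : ∀ u, C.Adj v u → u ∈ visited := by
        intro u hu
        by_contra hcon
        exact h ⟨u, by simp [hu, hcon]⟩
      match path with
      | [] =>
        exfalso
        refine huniv (hC.preconnected.eq_univ_of_adj_closed ⟨v, hpath v (by simp)⟩ ?_)
        intro w hw u hu
        by_cases hwv : w = v
        · exact hv u (hwv ▸ hu)
        · exact hclosed w hw (by simpa using hwv) u hu
      | u :: rest =>
        have key := ih visited (u :: rest) (by simp)
          (fun w hw => hpath w (List.mem_cons_of_mem _ hw))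
          (by
            intro w hw hwp y hy
            by_cases hwv : w = v
            · exact hv y (hwv ▸ hy)
            · exact hclosed w hw (by simp only [List.mem_cons] at hwp ⊢; tauto) y hy)
          (by simp only [List.length_cons] at hk ⊢; omega)
        rw [List.mem_cons]
        tauto

theorem mem_dfsSeq {n : ℕ} (C : SimpleGraph (Fin (n + 1))) [DecidableRel C.Adj]
    (hC : C.Connected) (x : Fin (n + 1)) : x ∈ dfsSeq C := by
  have := mem_or_mem_dfsFrom C hC (2 * n) {0} [0] (by simp) (by simp) (by simp) (by simp) x
  simpa [dfsSeq] using this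

theorem exists_dfsSeq_eq {n : ℕ} (hn : 1 ≤ n) (C : SimpleGraph (Fin (n + 1))) [DecidableRel C.Adj]
    (hC : C.Connected) : ∃ u l, C.Adj 0 u ∧ dfsSeq C = 0 :: u :: l := by
  obtain ⟨m, rfl⟩ := Nat.exists_eq_add_of_le' hn
  have hmem := mem_dfsSeq C hC (Fin.last (m + 1))
  have huniv : ({0} : Finset (Fin (m + 1 + 1))) ≠ Finset.univ := by
    intro h
    have := congrArg Finset.card h
    simp at this
  rw [dfsSeq, show 2 * (m + 1) = 2 * m + 1 + 1 by ring, dfsFrom, if_neg huniv] at hmem ⊢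
  split_ifs at hmem ⊢ with h
  · have hu := Finset.max'_mem _ h
    rw [Finset.mem_filter] at hu
    exact ⟨_, _, hu.2.1, rfl⟩
  · simp at hmem

theorem exists_dfsWord_eq {n : ℕ} (hn : 1 ≤ n) (C : SimpleGraph (Fin (n + 1)))
    [DecidableRel C.Adj] (hC : C.Connected) : ∃ u l, C.Adj 0 u ∧ dfsWord C = u :: l := by
  obtain ⟨u, l, hu, hl⟩ := exists_dfsSeq_eq hn C hC
  -- `dedup` keeps last occurrences, so the reversed sequence still ends in `u, 0` after it: the
  -- first letter of the word is the first vertex entered.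
  have hsuf : [u, 0] <:+ (dfsSeq C).reverse.dedup := by
    rw [hl, List.reverse_cons, List.reverse_cons, List.append_assoc, List.dedup_append]
    have : ([u] ++ [0] : List (Fin (n + 1))).dedup = [u, 0] := by
      simp [List.dedup_cons_of_notMem, hu.ne']
    rw [this]
    exact List.suffix_union_right _ _
  obtain ⟨t, ht⟩ := hsuf
  refine ⟨u, t.reverse.filter fun v => decide (v ≠ 0), hu, ?_⟩
  rw [dfsWord, ← ht]
  simp [hu.ne']

theorem nodup_dfsWord {n : ℕ} (C : SimpleGraph (Fin (n + 1))) [DecidableRel C.Adj] :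
    (dfsWord C).Nodup :=
  (List.nodup_reverse.2 (List.nodup_dedup _)).filter _

theorem mem_dfsWord {n : ℕ} (C : SimpleGraph (Fin (n + 1))) [DecidableRel C.Adj]
    (hC : C.Connected) (v : Fin (n + 1)) : v ∈ dfsWord C ↔ v ≠ 0 := by
  simp [dfsWord, mem_dfsSeq C hC v]

theorem toFinset_dfsWord {n : ℕ} (C : SimpleGraph (Fin (n + 1))) [DecidableRel C.Adj]
    (hC : C.Connected) : (dfsWord C).toFinset = Finset.univ.erase 0 := by
  ext v
  simp [mem_dfsWord C hC]

theorem length_dfsWord {n : ℕ} (C : SimpleGraph (Fin (n + 1))) [DecidableRel C.Adj]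
    (hC : C.Connected) : (dfsWord C).length = n := by
  rw [← List.toFinset_card_of_nodup (nodup_dfsWord C), toFinset_dfsWord C hC]
  simp

theorem countP_dfsWord {n : ℕ} (C : SimpleGraph (Fin (n + 1))) [DecidableRel C.Adj]
    (hC : C.Connected) : (dfsWord C).countP (fun v => decide (C.Adj 0 v)) = C.degree 0 := by
  rw [List.countP_eq_length_filter,
    ← List.toFinset_card_of_nodup ((nodup_dfsWord C).filter _), ← SimpleGraph.card_neighborFinset_eq_degree]
  congr 1
  ext v
  simp only [List.mem_toFinset, List.mem_filter, mem_dfsWord C hC, decide_eq_true_eq,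
    SimpleGraph.mem_neighborFinset, and_iff_right_iff_imp]
  exact fun h => h.ne'

/-- The finished groups, the group being built, and one new group for each later letter that
satisfies `p`. -/
theorem List.length_splitBy_loop {α : Type*} (p : α → Bool) (l : List α) (a : α) (g : List α)
    (gs : List (List α)) :
    (List.splitBy.loop (fun _ b => !p b) l a g gs).length = gs.length + 1 + l.countP p := by
  induction l generalizing a g gs with
  | nil => simp [List.splitBy.loop]
  | cons b l ih =>
    rw [List.splitBy.loop]
    cases hb : p b
    · simp [ih, hb]
    · simp [ih, hb]
      omega

/-- The first subword starts without a cut, but its first letter is a neighbour of the root too; so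
subwords correspond to root neighbours, each of which occurs once in the word. -/
theorem card_dfsParts {n : ℕ} (hn : 1 ≤ n) (C : SimpleGraph (Fin (n + 1))) [DecidableRel C.Adj]
    (hC : C.Connected) : (dfsParts C).card = C.degree 0 := by
  obtain ⟨u, l, hu, hl⟩ := exists_dfsWord_eq hn C hC
  have h := countP_dfsWord C hC
  rw [hl, List.countP_cons] at h
  rw [← h, dfsParts, Multiset.coe_card, List.length_map, dfsSubwords, hl, List.splitBy]
  have := List.length_splitBy_loop (fun v => decide (C.Adj 0 v)) l u [] []
  simp only [decide_not]
  rw [this]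
  simp [hu, add_comm]

theorem sum_dfsParts {n : ℕ} (C : SimpleGraph (Fin (n + 1))) [DecidableRel C.Adj]
    (hC : C.Connected) : (dfsParts C).sum = n := by
  rw [dfsParts, Multiset.sum_coe, ← List.length_flatten, dfsSubwords, List.flatten_splitBy,
    length_dfsWord C hC]

theorem pos_of_mem_dfsParts {n : ℕ} (C : SimpleGraph (Fin (n + 1))) [DecidableRel C.Adj]
    {i : ℕ} (hi : i ∈ dfsParts C) : 0 < i := by
  rw [dfsParts, Multiset.mem_coe, List.mem_map] at hi
  obtain ⟨l, hl, rfl⟩ := hi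
  exact List.length_pos_of_ne_nil (List.ne_nil_of_mem_splitBy hl)

/-! ### Partitions determined by their number of parts -/

theorem Multiset.card_le_sum_of_pos {s : Multiset ℕ} (hs : ∀ i ∈ s, 0 < i) : s.card ≤ s.sum := by
  simpa using Multiset.card_nsmul_le_sum (s := s) (a := 1) hs

theorem Multiset.eq_replicate_one_of_sum_eq_card {s : Multiset ℕ} (hs : ∀ i ∈ s, 0 < i)
    (h : s.sum = s.card) : s = Multiset.replicate s.card 1 := by
  refine Multiset.eq_replicate.2 ⟨rfl, fun a ha => ?_⟩
  obtain ⟨t, rfl⟩ := Multiset.exists_cons_of_mem ha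
  have := Multiset.card_le_sum_of_pos fun i hi => hs i (Multiset.mem_cons_of_mem hi)
  have := hs a ha
  simp only [Multiset.sum_cons, Multiset.card_cons] at h
  omega

/-- Some part is at least `2`, otherwise sum and cardinality agree. The other parts sum to at least
their number, which forces that part to be `2` and the others to be `1`. -/
theorem Multiset.eq_two_cons_replicate_one {s : Multiset ℕ} (hs : ∀ i ∈ s, 0 < i)
    (h : s.sum = s.card + 1) : s = 2 ::ₘ Multiset.replicate (s.card - 1) 1 := by
  obtain ⟨a, ha, ha2⟩ : ∃ a ∈ s, 2 ≤ a := by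
    by_contra! hcon
    have : s = Multiset.replicate s.card 1 :=
      Multiset.eq_replicate.2 ⟨rfl, fun a ha => by have := hs a ha; have := hcon a ha; omega⟩
    have h2 := congrArg Multiset.sum this
    rw [Multiset.sum_replicate] at h2
    simp at h2
    omega
  obtain ⟨t, rfl⟩ := Multiset.exists_cons_of_mem ha
  have ht : ∀ i ∈ t, 0 < i := fun i hi => hs i (Multiset.mem_cons_of_mem hi)
  have := Multiset.card_le_sum_of_pos ht
  simp only [Multiset.sum_cons, Multiset.card_cons] at h
  obtain rfl : a = 2 := by omega
  rw [Multiset.card_cons, Nat.add_sub_cancel,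
    ← Multiset.eq_replicate_one_of_sum_eq_card ht (by omega)]

/-- A partition of `n` with `1`, `n` or `n - 1` parts is the only one with its number of parts. -/
theorem eq_parts_of_card_eq {n : ℕ} {lam : n.Partition}
    (hlam : lam.parts = {n} ∨ lam.parts = Multiset.replicate n 1 ∨
      lam.parts = 2 ::ₘ Multiset.replicate (n - 2) 1)
    {s : Multiset ℕ} (hs : ∀ i ∈ s, 0 < i) (hsum : s.sum = n)
    (hcard : s.card = lam.parts.card) : s = lam.parts := by
  have hl := lam.parts_sum
  rcases hlam with h | h | h
  · rw [h, Multiset.card_singleton, Multiset.card_eq_one] at hcard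
    obtain ⟨a, rfl⟩ := hcard
    rw [h, ← hsum, Multiset.sum_singleton]
  · rw [h, Multiset.card_replicate] at hcard
    rw [h, Multiset.eq_replicate_one_of_sum_eq_card hs (by omega), hcard]
  · rw [h, Multiset.card_cons, Multiset.card_replicate] at hcard
    rw [h, Multiset.sum_cons, Multiset.sum_replicate, smul_eq_mul, mul_one] at hl
    rw [h, Multiset.eq_two_cons_replicate_one hs (by omega), hcard, Nat.add_sub_cancel]

open Classical in
theorem dfsGraphs_eq_rootDegreeGraphs {n : ℕ} (hn : 1 ≤ n) {lam : n.Partition}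
    (hlam : lam.parts = {n} ∨ lam.parts = Multiset.replicate n 1 ∨
      lam.parts = 2 ::ₘ Multiset.replicate (n - 2) 1) :
    dfsGraphs lam = rootDegreeGraphs n lam.parts.card := by
  rw [dfsGraphs, Finset.filter_eq_self]
  intro C hC
  rw [rootDegreeGraphs, Finset.mem_filter] at hC
  exact eq_parts_of_card_eq hlam (fun _ => pos_of_mem_dfsParts C) (sum_dfsParts C hC.2.1)
    ((card_dfsParts hn C hC.2.1).trans hC.2.2)

noncomputable section

/-! ### Edge enumerators of sets of graphs -/

open Classical in
/-- The edge enumerator of the graphs on `V` with the property `p`. -/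
def graphEnum (V : Type*) [Fintype V] [DecidableEq V] (p : SimpleGraph V → Prop) : ℚ[X] :=
  ∑ G : SimpleGraph V with p G, X ^ G.edgeSet.ncard

theorem graphEnum_eq_sum_filter (V : Type*) [Fintype V] [DecidableEq V]
    (p : SimpleGraph V → Prop) [DecidablePred p] :
    graphEnum V p = ∑ G : SimpleGraph V with p G, X ^ G.edgeSet.ncard := by
  rw [graphEnum]
  congr!

/-- The edge enumerator of the connected graphs with vertex set `Fin n`. -/
def connEnum (n : ℕ) : ℚ[X] := graphEnum (Fin n) SimpleGraph.Connected

theorem graphEnum_congr_equiv {V W : Type*} [Fintype V] [DecidableEq V] [Fintype W]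
    [DecidableEq W] (e : V ≃ W)
    {p : SimpleGraph V → Prop} {q : SimpleGraph W → Prop}
    (h : ∀ (G : SimpleGraph V) (H : SimpleGraph W), (G ≃g H) → (p G ↔ q H)) :
    graphEnum V p = graphEnum W q := by
  classical
  refine Finset.sum_equiv e.simpleGraph (fun G => ?_) (fun G _ => ?_)
  · simpa using h G _ (SimpleGraph.Iso.comap e.symm G).symm
  · have := Nat.card_congr (SimpleGraph.Iso.comap e.symm G).mapEdgeSet
    rw [Nat.card_coe_set_eq, Nat.card_coe_set_eq] at this
    rw [← this]
    rfl

theorem graphEnum_connected (V : Type*) [Fintype V] [DecidableEq V] :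
    graphEnum V SimpleGraph.Connected = connEnum (Fintype.card V) :=
  graphEnum_congr_equiv (Fintype.equivFin V) fun _ _ e => e.connected_iff

/-! ### Removing a vertex -/

/-- The graph obtained from a graph on `Fin n` by inserting a vertex `v` with neighbours `A`. -/
def attachVertex {n : ℕ} (v : Fin (n + 1)) (A : Finset (Fin n)) (K : SimpleGraph (Fin n)) :
    SimpleGraph (Fin (n + 1)) :=
  K.map v.succAboveEmb ⊔ SimpleGraph.fromEdgeSet ((fun a => s(v, v.succAbove a)) '' A)

theorem attachVertex_adj_succAbove {n : ℕ} (v : Fin (n + 1)) (A : Finset (Fin n))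
    (K : SimpleGraph (Fin n)) (a b : Fin n) :
    (attachVertex v A K).Adj (v.succAbove a) (v.succAbove b) ↔ K.Adj a b := by
  simp only [attachVertex, SimpleGraph.sup_adj, SimpleGraph.fromEdgeSet_adj, Set.mem_image,
    Sym2.eq_iff]
  constructor
  · rintro (h | ⟨⟨c, -, ⟨h, -⟩ | ⟨h, -⟩⟩, -⟩)
    · exact (SimpleGraph.map_adj_apply (f := v.succAboveEmb)).1 h
    · exact absurd h.symm (Fin.succAbove_ne v a)
    · exact absurd h.symm (Fin.succAbove_ne v b)
  · exact fun h => Or.inl ((SimpleGraph.map_adj_apply (f := v.succAboveEmb)).2 h)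

theorem attachVertex_adj_self {n : ℕ} (v : Fin (n + 1)) (A : Finset (Fin n))
    (K : SimpleGraph (Fin n)) (a : Fin n) :
    (attachVertex v A K).Adj v (v.succAbove a) ↔ a ∈ A := by
  simp only [attachVertex, SimpleGraph.sup_adj, SimpleGraph.fromEdgeSet_adj, Set.mem_image,
    Sym2.eq_iff, SimpleGraph.map_adj]
  constructor
  · rintro (⟨c, d, -, h, -⟩ | ⟨⟨c, hc, ⟨-, h⟩ | ⟨h, -⟩⟩, -⟩)
    · exact absurd h (Fin.succAbove_ne v c)
    · rw [Fin.succAbove_right_inj] at h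
      exact h ▸ hc
    · exact absurd h.symm (Fin.succAbove_ne v a)
  · exact fun h => Or.inr ⟨⟨a, h, Or.inl ⟨trivial, rfl⟩⟩, (Fin.succAbove_ne v a).symm⟩

open Classical in
/-- A graph on `Fin (n + 1)` amounts to the neighbours of the vertex `v` and the graph induced on
the other vertices. -/
def attachVertexEquiv {n : ℕ} (v : Fin (n + 1)) :
    Finset (Fin n) × SimpleGraph (Fin n) ≃ SimpleGraph (Fin (n + 1)) where
  toFun x := attachVertex v x.1 x.2
  invFun G := (Finset.univ.filter fun a => G.Adj v (v.succAbove a), G.comap v.succAbove)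
  left_inv x := by
    ext a b
    · simp [attachVertex_adj_self]
    · simp [attachVertex_adj_succAbove]
  right_inv G := by
    ext x y
    rcases Fin.eq_self_or_eq_succAbove v x with hx | ⟨a, rfl⟩ <;>
    rcases Fin.eq_self_or_eq_succAbove v y with hy | ⟨b, rfl⟩
    · simp [hx, hy]
    · simp [hx, attachVertex_adj_self]
    · simp [hy, attachVertex_adj_self, SimpleGraph.adj_comm _ _ v]
    · simp [attachVertex_adj_succAbove]

theorem ncard_edgeSet_attachVertex {n : ℕ} (v : Fin (n + 1)) (A : Finset (Fin n))
    (K : SimpleGraph (Fin n)) :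
    (attachVertex v A K).edgeSet.ncard = A.card + K.edgeSet.ncard := by
  have hinj : Function.Injective fun a : Fin n => s(v, v.succAbove a) := by
    intro a b h
    simpa using h
  have h1 : (SimpleGraph.fromEdgeSet ((fun a => s(v, v.succAbove a)) '' (A : Set (Fin n)))).edgeSet
      = (fun a => s(v, v.succAbove a)) '' (A : Set (Fin n)) := by
    rw [SimpleGraph.edgeSet_fromEdgeSet, sdiff_eq_left, Set.disjoint_left]
    rintro _ ⟨a, -, rfl⟩ h
    exact Fin.succAbove_ne v a (by simpa only [Sym2.mem_diagSet, Sym2.mk_isDiag_iff] using h : v = v.succAbove a).symm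
  rw [attachVertex, SimpleGraph.edgeSet_sup, h1, SimpleGraph.edgeSet_map, Set.ncard_union_eq,
    Set.ncard_image_of_injective _ hinj, Set.ncard_coe_finset, add_comm,
    Set.ncard_image_of_injective _ (Function.Embedding.injective _)]
  rw [Set.disjoint_left]
  rintro _ ⟨e, -, rfl⟩ ⟨a, -, h⟩
  have : v ∈ Sym2.map v.succAbove e := by
    have h' : s(v, v.succAbove a) = Sym2.map v.succAbove e := h
    rw [← h']
    exact Sym2.mem_mk_left _ _
  obtain ⟨b, -, hb⟩ := Sym2.mem_map.1 this
  exact Fin.succAbove_ne v b hb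

theorem sum_simpleGraph_eq {M : Type*} [AddCommMonoid M] {n : ℕ} (v : Fin (n + 1))
    (f : SimpleGraph (Fin (n + 1)) → M) :
    ∑ G, f G = ∑ A : Finset (Fin n), ∑ K : SimpleGraph (Fin n), f (attachVertex v A K) := by
  rw [← (attachVertexEquiv v).sum_comp, Fintype.sum_prod_type]
  rfl

theorem sum_X_pow_card (n : ℕ) : ∑ A : Finset (Fin n), (X : ℚ[X]) ^ A.card = (1 + X) ^ n := by
  simpa [add_comm] using Fintype.sum_pow_mul_eq_add_pow (Fin n) (X : ℚ[X]) 1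

theorem sum_X_pow_edgeSet_fin (n : ℕ) :
    ∑ G : SimpleGraph (Fin n), (X : ℚ[X]) ^ G.edgeSet.ncard = (1 + X) ^ n.choose 2 := by
  induction n with
  | zero => simp
  | succ n ih =>
    rw [sum_simpleGraph_eq 0]
    simp_rw [ncard_edgeSet_attachVertex, pow_add, ← Finset.mul_sum, ih, ← Finset.sum_mul,
      sum_X_pow_card, ← pow_add]
    rw [Nat.choose_succ_succ' n 1, Nat.choose_one_right]

theorem sum_X_pow_edgeSet (V : Type*) [Fintype V] [DecidableEq V] :
    graphEnum V (fun _ => True) = (1 + X) ^ (Fintype.card V).choose 2 := by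
  rw [← sum_X_pow_edgeSet_fin, graphEnum_congr_equiv (Fintype.equivFin V) (q := fun _ => True)
    (by simp), graphEnum]
  simp

/-- Along a walk from `x` to `v`, the vertex just before the first arrival at `v` lies in `A`, and
the walk up to there stays in `K`. -/
theorem connected_attachVertex_iff {n : ℕ} (v : Fin (n + 1)) (A : Finset (Fin n))
    (K : SimpleGraph (Fin n)) :
    (attachVertex v A K).Connected ↔ ∀ x, ∃ a ∈ A, K.Reachable x a := by
  constructor
  · intro h x
    have key : ∀ {y z : Fin (n + 1)} (w : (attachVertex v A K).Walk y z), z = v →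
        ∀ x, y = v.succAbove x → ∃ a ∈ A, K.Reachable x a := by
      intro y z w hz
      induction w with
      | nil =>
        rintro x rfl
        exact absurd hz (Fin.succAbove_ne v x)
      | @cons y y' z hadj w ih =>
        rintro x rfl
        rcases Fin.eq_self_or_eq_succAbove v y' with rfl | ⟨b, rfl⟩
        · exact ⟨x, (attachVertex_adj_self _ A K x).1 hadj.symm, SimpleGraph.Reachable.refl x⟩
        · obtain ⟨a, ha, hb⟩ := ih hz b rfl
          exact ⟨a, ha, ((attachVertex_adj_succAbove v A K x b).1 hadj).reachable.trans hb⟩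
    obtain ⟨w⟩ := h.preconnected (v.succAbove x) v
    exact key w rfl x rfl
  · intro h
    rw [SimpleGraph.connected_iff_exists_forall_reachable]
    refine ⟨v, fun y => ?_⟩
    rcases Fin.eq_self_or_eq_succAbove v y with rfl | ⟨x, rfl⟩
    · exact SimpleGraph.Reachable.refl _
    · obtain ⟨a, ha, hxa⟩ := h x
      let f : K →g attachVertex v A K :=
        ⟨v.succAbove, fun {a b} hab => (attachVertex_adj_succAbove v A K a b).2 hab⟩
      exact ((attachVertex_adj_self v A K a).2 ha).reachable.trans (hxa.map f).symm

theorem degree_attachVertex {n : ℕ} (v : Fin (n + 1)) (A : Finset (Fin n))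
    (K : SimpleGraph (Fin n)) [Fintype ((attachVertex v A K).neighborSet v)] :
    (attachVertex v A K).degree v = A.card := by
  rw [← SimpleGraph.card_neighborFinset_eq_degree, ← Finset.card_map v.succAboveEmb (s := A)]
  congr 1
  ext y
  rw [SimpleGraph.mem_neighborFinset, Finset.mem_map]
  rcases Fin.eq_self_or_eq_succAbove v y with rfl | ⟨x, rfl⟩
  · simp [Fin.succAbove_ne]
  · simp [attachVertex_adj_self]

/-! ### Graphs with a root of given degree -/

open Classical in
theorem edgeEnumerator_rootDegreeGraphs (n s : ℕ) :
    edgeEnumerator (rootDegreeGraphs n s) = ∑ A : Finset (Fin n) with A.card = s,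
      X ^ s * graphEnum (Fin n) fun K => ∀ x, ∃ a ∈ A, K.Reachable x a := by
  have h : edgeEnumerator (rootDegreeGraphs n s) = ∑ C : SimpleGraph (Fin (n + 1)),
      if C.Connected ∧ C.degree 0 = s then X ^ C.edgeSet.ncard else 0 := by
    rw [edgeEnumerator, rootDegreeGraphs, Finset.sum_filter]
    refine Finset.sum_congr rfl fun C _ => ?_
    rw [← SimpleGraph.coe_edgeFinset, Set.ncard_coe_finset]
  rw [h, sum_simpleGraph_eq 0, Finset.sum_filter]
  refine Finset.sum_congr rfl fun A _ => ?_
  simp_rw [degree_attachVertex, connected_attachVertex_iff, ncard_edgeSet_attachVertex]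
  split_ifs with hA
  · rw [graphEnum, Finset.mul_sum, Finset.sum_filter]
    simp only [hA, pow_add, and_true]
    congr!
  · simp [hA]

theorem edgeEnumerator_rootDegreeGraphs_one (n : ℕ) :
    edgeEnumerator (rootDegreeGraphs n 1) = (n : ℚ[X]) * X * connEnum n := by
  classical
  rw [edgeEnumerator_rootDegreeGraphs]
  have h : (Finset.univ.filter fun A : Finset (Fin n) => A.card = 1) =
      Finset.univ.map ⟨fun a => {a}, Finset.singleton_injective⟩ := by
    ext A
    simp [Finset.card_eq_one, eq_comm]
  rw [h, Finset.sum_map, Finset.sum_congr rfl (g := fun _ => X * connEnum n), Finset.sum_const]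
  · simp [mul_assoc]
  · intro a _
    rw [pow_one, connEnum]
    congr 2
    ext K
    simp only [Function.Embedding.coeFn_mk, Finset.mem_singleton, exists_eq_left]
    rw [SimpleGraph.connected_iff_exists_forall_reachable]
    exact ⟨fun h => ⟨a, fun x => (h x).symm⟩,
      fun ⟨b, hb⟩ x => (hb x).symm.trans (hb a)⟩

theorem edgeEnumerator_rootDegreeGraphs_self (n : ℕ) :
    edgeEnumerator (rootDegreeGraphs n n) = X ^ n * (1 + X) ^ n.choose 2 := by
  classical
  rw [edgeEnumerator_rootDegreeGraphs]
  have h : (Finset.univ.filter fun A : Finset (Fin n) => A.card = n) = {Finset.univ} := by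
    ext A
    simp [← Finset.card_eq_iff_eq_univ]
  rw [h, Finset.sum_singleton, ← sum_X_pow_edgeSet_fin, graphEnum_eq_sum_filter]
  congr 1
  refine Finset.sum_congr (Finset.filter_true_of_mem fun K _ x => ?_) fun _ _ => rfl
  exact ⟨x, Finset.mem_univ _, SimpleGraph.Reachable.refl x⟩

/-- Only `b` can fail to reach the complement of `b`, and it fails exactly when isolated. Removing
`b` leaves a nonempty neighbour set and an arbitrary graph on `m` vertices. -/
theorem graphEnum_reachable_erase {m : ℕ} (b : Fin (m + 1)) :
    graphEnum (Fin (m + 1)) (fun K => ∀ x, ∃ a ∈ ({b}ᶜ : Finset (Fin (m + 1))), K.Reachable x a) =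
      ((1 + X) ^ m - 1) * (1 + X) ^ m.choose 2 := by
  classical
  have h (B : Finset (Fin m)) (K : SimpleGraph (Fin m)) :
      (∀ x, ∃ a ∈ ({b}ᶜ : Finset (Fin (m + 1))), (attachVertex b B K).Reachable x a) ↔ B ≠ ∅ := by
    constructor
    · rintro h rfl
      obtain ⟨a, ha, ⟨w⟩⟩ := h b
      cases w with
      | nil => simp at ha
      | @cons _ y _ hadj _ =>
        rcases Fin.eq_self_or_eq_succAbove b y with rfl | ⟨c, rfl⟩
        · exact hadj.ne rfl
        · simpa using (attachVertex_adj_self b ∅ K c).1 hadj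
    · intro hB x
      rcases Fin.eq_self_or_eq_succAbove b x with rfl | ⟨c, rfl⟩
      · obtain ⟨c, hc⟩ := Finset.nonempty_iff_ne_empty.2 hB
        exact ⟨x.succAbove c, by simp [Fin.succAbove_ne],
          ((attachVertex_adj_self x B K c).2 hc).reachable⟩
      · exact ⟨b.succAbove c, by simp [Fin.succAbove_ne], SimpleGraph.Reachable.refl _⟩
  rw [graphEnum, Finset.sum_filter, sum_simpleGraph_eq b]
  simp_rw [h, ncard_edgeSet_attachVertex, pow_add]
  have h2 : ∀ B : Finset (Fin m), (∑ K : SimpleGraph (Fin m),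
      if B ≠ ∅ then (X : ℚ[X]) ^ B.card * X ^ K.edgeSet.ncard else 0) =
      (X ^ B.card - if B = ∅ then 1 else 0) * (1 + X) ^ m.choose 2 := by
    intro B
    rw [← sum_X_pow_edgeSet_fin, Finset.mul_sum]
    refine Finset.sum_congr rfl fun K _ => ?_
    by_cases hB : B = ∅ <;> simp [hB]
  simp_rw [h2, ← Finset.sum_mul, Finset.sum_sub_distrib, sum_X_pow_card]
  simp

theorem filter_card_eq_map_compl (m : ℕ) :
    (Finset.univ.filter fun A : Finset (Fin (m + 1)) => A.card = m) =
      Finset.univ.map ⟨fun b => ({b}ᶜ : Finset (Fin (m + 1))),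
        compl_injective.comp Finset.singleton_injective⟩ := by
  ext A
  have hc := A.card_add_card_compl
  rw [Fintype.card_fin] at hc
  have : A.card = m ↔ Aᶜ.card = 1 := by omega
  rw [Finset.mem_filter_univ, this, Finset.card_eq_one, Finset.mem_map]
  simp [eq_compl_comm, eq_comm]

theorem edgeEnumerator_rootDegreeGraphs_succ (m : ℕ) :
    edgeEnumerator (rootDegreeGraphs (m + 1) m) =
      ((m + 1 : ℕ) : ℚ[X]) * X ^ m * ((1 + X) ^ m - 1) * (1 + X) ^ m.choose 2 := by
  classical
  rw [edgeEnumerator_rootDegreeGraphs]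
  rw [filter_card_eq_map_compl, Finset.sum_map]
  simp only [Function.Embedding.coeFn_mk, graphEnum_reachable_erase]
  rw [Finset.sum_const]
  simp only [Finset.card_univ, Fintype.card_fin, nsmul_eq_mul]
  ring

/-! ### Splitting off the component of a vertex -/

theorem SimpleGraph.Reachable.induce_of_adj_closed {V : Type*} {G : SimpleGraph V} {s : Set V}
    (hs : ∀ v ∈ s, ∀ u, G.Adj v u → u ∈ s) {x y : V} (h : G.Reachable x y) (hx : x ∈ s) :
    ∃ hy : y ∈ s, (G.induce s).Reachable ⟨x, hx⟩ ⟨y, hy⟩ := by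
  obtain ⟨w⟩ := h
  induction w with
  | nil => exact ⟨hx, SimpleGraph.Reachable.refl _⟩
  | @cons x z y hadj w ih =>
    obtain ⟨hy, hr⟩ := ih (hs _ hx _ hadj)
    refine ⟨hy, SimpleGraph.Reachable.trans (SimpleGraph.Adj.reachable ?_) hr⟩
    exact hadj

/-- The disjoint union of graphs on a set of vertices and on its complement. -/
def glueGraphs {V : Type*} {s : Set V} (H : SimpleGraph s) (K : SimpleGraph ↥sᶜ) :
    SimpleGraph V :=
  H.map (Function.Embedding.subtype _) ⊔ K.map (Function.Embedding.subtype _)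

theorem glueGraphs_adj {V : Type*} {s : Set V} (H : SimpleGraph s) (K : SimpleGraph ↥sᶜ)
    (x y : V) : (glueGraphs H K).Adj x y ↔ (∃ a b : s, H.Adj a b ∧ (a : V) = x ∧ (b : V) = y) ∨
      ∃ a b : ↥sᶜ, K.Adj a b ∧ (a : V) = x ∧ (b : V) = y := by
  rw [glueGraphs, SimpleGraph.sup_adj, SimpleGraph.map_adj, SimpleGraph.map_adj]
  rfl

theorem induce_glueGraphs {V : Type*} {s : Set V} (H : SimpleGraph s) (K : SimpleGraph ↥sᶜ) :
    (glueGraphs H K).induce s = H := by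
  ext ⟨x, hx⟩ ⟨y, hy⟩
  simp [glueGraphs_adj, hx, hy]

theorem induce_compl_glueGraphs {V : Type*} {s : Set V} (H : SimpleGraph s)
    (K : SimpleGraph ↥sᶜ) : (glueGraphs H K).induce sᶜ = K := by
  ext ⟨x, hx⟩ ⟨y, hy⟩
  rw [Set.mem_compl_iff] at hx hy
  simp [glueGraphs_adj, hx, hy]

theorem glueGraphs_closed {V : Type*} {s : Set V} (H : SimpleGraph s) (K : SimpleGraph ↥sᶜ) :
    ∀ v ∈ s, ∀ u, (glueGraphs H K).Adj v u → u ∈ s := by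
  intro v hv u h
  rw [glueGraphs_adj] at h
  rcases h with ⟨a, b, -, -, rfl⟩ | ⟨a, b, -, rfl, -⟩
  · exact b.2
  · exact absurd hv a.2

theorem glueGraphs_induce {V : Type*} {s : Set V} {G : SimpleGraph V}
    (hs : ∀ v ∈ s, ∀ u, G.Adj v u → u ∈ s) :
    glueGraphs (G.induce s) (G.induce sᶜ) = G := by
  ext x y
  rw [glueGraphs_adj]
  constructor
  · rintro (⟨a, b, h, rfl, rfl⟩ | ⟨a, b, h, rfl, rfl⟩) <;> exact h
  · intro h
    by_cases hx : x ∈ s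
    · exact Or.inl ⟨⟨x, hx⟩, ⟨y, hs x hx y h⟩, h, rfl, rfl⟩
    · exact Or.inr ⟨⟨x, hx⟩, ⟨y, fun hy => hx (hs y hy x h.symm)⟩, h, rfl, rfl⟩

theorem ncard_edgeSet_glueGraphs {V : Type*} [Finite V] {s : Set V} (H : SimpleGraph s)
    (K : SimpleGraph ↥sᶜ) :
    (glueGraphs H K).edgeSet.ncard = H.edgeSet.ncard + K.edgeSet.ncard := by
  rw [glueGraphs, SimpleGraph.edgeSet_sup, SimpleGraph.edgeSet_map, SimpleGraph.edgeSet_map,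
    Set.ncard_union_eq, Set.ncard_image_of_injective _ (Function.Embedding.injective _),
    Set.ncard_image_of_injective _ (Function.Embedding.injective _)]
  rw [Set.disjoint_left]
  rintro _ ⟨e, -, rfl⟩ ⟨f, -, h⟩
  induction e with | _ a b
  induction f with | _ c d
  have h' : s((c : V), (d : V)) = s((a : V), (b : V)) := h
  rcases Sym2.eq_iff.1 h' with ⟨h, -⟩ | ⟨h, -⟩
  · exact c.2 (h ▸ a.2)
  · exact c.2 (h ▸ b.2)

/-- Such a graph is the disjoint union of a connected graph on `s` and an arbitrary graph on the
complement. -/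
theorem graphEnum_component {V : Type*} [Fintype V] [DecidableEq V] {v : V} {s : Set V} (hv : v ∈ s) :
    graphEnum V (fun G => {x | G.Reachable v x} = s) =
      connEnum s.ncard * (1 + X) ^ (sᶜ.ncard).choose 2 := by
  classical
  rw [← Nat.card_coe_set_eq, ← Nat.card_coe_set_eq, Nat.card_eq_fintype_card,
    Nat.card_eq_fintype_card, ← graphEnum_connected, ← sum_X_pow_edgeSet]
  simp only [graphEnum]
  rw [Finset.sum_mul_sum, ← Finset.sum_product']
  have hclosed {G : SimpleGraph V} (hG : {x | G.Reachable v x} = s) :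
      ∀ v ∈ s, ∀ u, G.Adj v u → u ∈ s := by
    subst hG
    exact fun x hx u hu => SimpleGraph.Reachable.trans hx hu.reachable
  refine Finset.sum_nbij' (fun G => (G.induce s, G.induce sᶜ)) (fun x => glueGraphs x.1 x.2)
    ?_ ?_ ?_ ?_ ?_
  · intro G hG
    rw [Finset.mem_filter_univ] at hG
    simp only [Finset.mem_product, Finset.mem_filter_univ, and_true]
    rw [SimpleGraph.connected_iff_exists_forall_reachable]
    refine ⟨⟨v, hv⟩, fun ⟨x, hx⟩ => ?_⟩
    have hr : G.Reachable v x := by rw [← hG] at hx; exact hx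
    exact (hr.induce_of_adj_closed (hclosed hG) hv).2
  · rintro ⟨H, K⟩ h
    simp only [Finset.mem_product, Finset.mem_filter_univ, and_true] at h ⊢
    ext x
    constructor
    · exact fun hx => (SimpleGraph.Reachable.induce_of_adj_closed (glueGraphs_closed H K) hx hv).1
    · intro hx
      have hr := h.preconnected ⟨v, hv⟩ ⟨x, hx⟩
      rw [← induce_glueGraphs H K] at hr
      exact hr.map (SimpleGraph.Embedding.induce s).toHom
  · intro G hG
    rw [Finset.mem_filter_univ] at hG
    exact glueGraphs_induce (hclosed hG)
  · rintro ⟨H, K⟩ -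
    exact Prod.ext (induce_glueGraphs H K) (induce_compl_glueGraphs H K)
  · intro G hG
    rw [Finset.mem_filter_univ] at hG
    dsimp only
    rw [← pow_add, ← ncard_edgeSet_glueGraphs, glueGraphs_induce (hclosed hG)]

/-- All graphs on `m + 1` vertices are sorted by the component of `0`; `j` counts its other
vertices. -/
theorem one_add_X_pow_choose_two (m : ℕ) : (1 + X : ℚ[X]) ^ (m + 1).choose 2 =
    ∑ j ∈ Finset.range (m + 1), m.choose j • (connEnum (j + 1) * (1 + X) ^ (m - j).choose 2) := by
  classical
  rw [← sum_X_pow_edgeSet_fin, ← Finset.sum_fiberwise Finset.univ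
    (fun G : SimpleGraph (Fin (m + 1)) => Finset.univ.filter fun x => G.Reachable 0 x)]
  have hcard : (Finset.univ.erase (0 : Fin (m + 1))).card = m := by simp
  have h := Finset.sum_powerset_apply_card
    (fun j => connEnum (j + 1) * (1 + X) ^ (m - j).choose 2) (x := Finset.univ.erase (0 : Fin (m + 1)))
  rw [hcard] at h
  rw [← h]
  have h0 : ∀ S : Finset (Fin (m + 1)), 0 ∉ S →
      (∑ G : SimpleGraph (Fin (m + 1)) with (Finset.univ.filter fun x => G.Reachable 0 x) = S,
        (X : ℚ[X]) ^ G.edgeSet.ncard) = 0 := by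
    intro S hS
    rw [Finset.filter_eq_empty_iff.2, Finset.sum_empty]
    rintro G - rfl
    simp at hS
  -- Sets without `0` are never a component of `0`. Discarding them makes erasing and inserting `0`
  -- inverse bijections with the subsets of the other vertices.
  rw [← Finset.sum_filter_of_ne (p := fun S => 0 ∈ S)
    (fun S _ hne => by by_contra hcon; exact hne (h0 S hcon))]
  refine Finset.sum_nbij' (fun S => S.erase 0) (fun T => insert 0 T) ?_ ?_ ?_ ?_ ?_
  · intro S _
    exact Finset.mem_powerset.2 (Finset.erase_subset_erase _ (Finset.subset_univ _))
  · simp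
  · intro S hS
    exact Finset.insert_erase (by simpa using hS)
  · intro T hT
    exact Finset.erase_insert fun h => by simpa using Finset.mem_powerset.1 hT h
  · intro S hS
    rw [Finset.mem_filter_univ] at hS
    have key := graphEnum_component (V := Fin (m + 1)) (v := 0) (s := (S : Set (Fin (m + 1)))) hS
    have hc := S.card_add_card_compl
    rw [Fintype.card_fin] at hc
    have h1 : S.card = (S.erase 0).card + 1 := (Finset.card_erase_add_one hS).symm
    have h2 : Sᶜ.card = m - (S.erase 0).card := by omega
    rw [← Finset.coe_compl, Set.ncard_coe_finset, Set.ncard_coe_finset, h1, h2] at key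
    rw [← key, graphEnum]
    refine Finset.sum_congr (Finset.filter_congr fun G _ => ?_) fun _ _ => rfl
    rw [← Finset.coe_inj]
    simp

theorem X_pow_dvd_connEnum (n : ℕ) : (X : ℚ[X]) ^ (n - 1) ∣ connEnum n := by
  classical
  rw [connEnum, graphEnum_eq_sum_filter]
  refine Finset.dvd_sum fun G hG => pow_dvd_pow X ?_
  rw [Finset.mem_filter_univ] at hG
  have := hG.card_vert_le_card_edgeSet_add_one
  rw [Nat.card_coe_set_eq, Nat.card_eq_fintype_card, Fintype.card_fin] at this
  omega

/-! ### The specialized elementary symmetric functions and power sums -/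

theorem specialization_esymm {n k : ℕ} (hk : k ≤ n) :
    specialization n ⟨MvPolynomial.esymm (Fin n) ℚ k, MvPolynomial.esymm_isSymmetric _ _ k⟩ =
      C (1 / (k.factorial : ℚ)) * X ^ k.choose 2 := by
  rcases k with _ | k
  -- `e_0 = 1` is not one of the free generators, hence the separate case.
  · have : (⟨MvPolynomial.esymm (Fin n) ℚ 0, MvPolynomial.esymm_isSymmetric _ _ 0⟩ :
        MvPolynomial.symmetricSubalgebra (Fin n) ℚ) = 1 :=
      Subtype.ext (MvPolynomial.esymm_zero (Fin n) ℚ)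
    rw [this, map_one]
    simp
  · have h := MvPolynomial.esymmAlgEquiv_symm_apply (σ := Fin n) (R := ℚ) (Fintype.card_fin n)
      ⟨k, hk⟩
    simp only at h
    rw [specialization, AlgHom.comp_apply]
    erw [h]
    rw [MvPolynomial.aeval_X]

theorem specialization_mk_congr {n : ℕ} {p q : MvPolynomial (Fin n) ℚ} (hp : p.IsSymmetric)
    (hq : q.IsSymmetric) (h : p = q) : specialization n ⟨p, hp⟩ = specialization n ⟨q, hq⟩ := by
  subst h
  rfl

theorem powersetCard_self_univ (n : ℕ) :
    Finset.powersetCard n (Finset.univ : Finset (Fin n)) = {Finset.univ} := by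
  have h := Finset.powersetCard_self (Finset.univ : Finset (Fin n))
  rwa [Finset.card_fin] at h

/-- Newton's identity for `(m+1) e_(m+1)`, with `(m+1)/(m+1)! = 1/m!` and the terms indexed by the
power sum `p_(j+1)`. -/
theorem specialization_newton {n m : ℕ} (hm : m < n) :
    C (1 / (m.factorial : ℚ)) * X ^ (m + 1).choose 2 = ∑ j ∈ Finset.range (m + 1),
      (-1) ^ j * (C (1 / ((m - j).factorial : ℚ)) * X ^ (m - j).choose 2) *
        specialization n ⟨MvPolynomial.psum (Fin n) ℚ (j + 1),
          MvPolynomial.psum_isSymmetric _ _ (j + 1)⟩ := by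
  let e (k : ℕ) : MvPolynomial.symmetricSubalgebra (Fin n) ℚ :=
    ⟨MvPolynomial.esymm (Fin n) ℚ k, MvPolynomial.esymm_isSymmetric _ _ k⟩
  let p (k : ℕ) : MvPolynomial.symmetricSubalgebra (Fin n) ℚ :=
    ⟨MvPolynomial.psum (Fin n) ℚ k, MvPolynomial.psum_isSymmetric _ _ k⟩
  have hnewton : ((m + 1 : ℕ) : MvPolynomial.symmetricSubalgebra (Fin n) ℚ) * e (m + 1) =
      (-1) ^ (m + 1 + 1) * ∑ a ∈ Finset.HasAntidiagonal.antidiagonal (m + 1) with a.1 < m + 1,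
        (-1) ^ a.1 * e a.1 * p a.2 := by
    apply Subtype.ext
    have := MvPolynomial.mul_esymm_eq_sum (Fin n) ℚ (m + 1)
    simpa [e, p] using this
  have hreindex : ∀ f : ℕ → ℕ → ℚ[X],
      ∑ a ∈ Finset.HasAntidiagonal.antidiagonal (m + 1) with a.1 < m + 1, f a.1 a.2 =
        ∑ j ∈ Finset.range (m + 1), f (m - j) (j + 1) := by
    intro f
    refine Finset.sum_nbij' (fun a => a.2 - 1) (fun j => (m - j, j + 1)) ?_ ?_ ?_ ?_ ?_
    · rintro ⟨a, b⟩ h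
      simp only [Finset.mem_filter, Finset.HasAntidiagonal.mem_antidiagonal, Finset.mem_range] at h ⊢
      omega
    · intro j h
      simp only [Finset.mem_filter, Finset.HasAntidiagonal.mem_antidiagonal, Finset.mem_range] at h ⊢
      omega
    · rintro ⟨a, b⟩ h
      simp only [Finset.mem_filter, Finset.HasAntidiagonal.mem_antidiagonal] at h
      ext <;> simp only <;> omega
    · intro j _
      simp
    · rintro ⟨a, b⟩ h
      simp only [Finset.mem_filter, Finset.HasAntidiagonal.mem_antidiagonal] at h
      dsimp only
      congr 1 <;> omega
  have hs := congrArg (specialization n) hnewton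
  simp only [map_mul, map_natCast, map_pow, map_neg, map_one, map_sum] at hs
  rw [hreindex fun a b => (-1) ^ a * specialization n (e a) * specialization n (p b),
    specialization_esymm (Nat.succ_le_of_lt hm), ← mul_assoc, Finset.mul_sum] at hs
  have hfac : ((m + 1 : ℕ) : ℚ[X]) * C (1 / ((m + 1).factorial : ℚ)) =
      C (1 / (m.factorial : ℚ)) := by
    rw [← Polynomial.C_eq_natCast, ← C_mul, Nat.factorial_succ]
    congr 1
    push_cast
    field_simp
  rw [hfac] at hs
  rw [hs]
  refine Finset.sum_congr rfl fun j hj => ?_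
  rw [Finset.mem_range] at hj
  rw [specialization_esymm (show m - j ≤ n by omega), ← mul_assoc, ← mul_assoc, ← pow_add]
  congr 2
  rw [show m + 1 + 1 + (m - j) = j + 2 * (m + 1 - j) by omega, pow_add, pow_mul]
  simp

theorem X_pow_choose_two (m : ℕ) : (X : ℚ[X]) ^ (m + 1).choose 2 =
    ∑ j ∈ Finset.range (m + 1),
      m.choose j • ((connEnum (j + 1)).comp (X - 1) * X ^ (m - j).choose 2) := by
  have h := congrArg (fun p : ℚ[X] => p.comp (X - 1)) (one_add_X_pow_choose_two m)
  simpa [sum_comp] using h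

/-- Both sides satisfy the same recursion: `specialization_newton` on the left, `X_pow_choose_two`
on the right, where `(m choose j)/m! = 1/(j! (m-j)!)`. The top term `j = m` has the invertible
coefficient `(-1)^m`, so strong induction applies. -/
theorem specialization_psum {n j : ℕ} (hj : j < n) :
    specialization n ⟨MvPolynomial.psum (Fin n) ℚ (j + 1),
      MvPolynomial.psum_isSymmetric _ _ (j + 1)⟩ =
        (-1) ^ j * C (1 / (j.factorial : ℚ)) * (connEnum (j + 1)).comp (X - 1) := by
  induction j using Nat.strong_induction_on with
  | _ m ih =>
  have h1 := specialization_newton hj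
  have h2 : C (1 / (m.factorial : ℚ)) * (X : ℚ[X]) ^ (m + 1).choose 2 =
      ∑ j ∈ Finset.range (m + 1),
        (-1) ^ j * (C (1 / ((m - j).factorial : ℚ)) * X ^ (m - j).choose 2) *
          ((-1) ^ j * C (1 / (j.factorial : ℚ)) * (connEnum (j + 1)).comp (X - 1)) := by
    rw [X_pow_choose_two, Finset.mul_sum]
    refine Finset.sum_congr rfl fun j hj => ?_
    rw [Finset.mem_range] at hj
    have hc : C (1 / (m.factorial : ℚ)) * ((m.choose j : ℕ) : ℚ[X]) =
        C (1 / ((m - j).factorial : ℚ)) * C (1 / (j.factorial : ℚ)) := by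
      rw [← Polynomial.C_eq_natCast, ← C_mul, ← C_mul, Nat.cast_choose ℚ (by omega : j ≤ m)]
      congr 1
      field_simp
    have hsq : ((-1 : ℚ[X]) ^ j) * (-1) ^ j = 1 := by rw [← mul_pow]; simp
    rw [nsmul_eq_mul, ← mul_assoc, hc]
    linear_combination (-C (1 / ((m - j).factorial : ℚ)) * C (1 / (j.factorial : ℚ)) *
      (connEnum (j + 1)).comp (X - 1) * X ^ (m - j).choose 2) * hsq
  rw [h1, Finset.sum_range_succ, Finset.sum_range_succ] at h2
  rw [Finset.sum_congr rfl fun j hj' => by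
    rw [ih j (Finset.mem_range.1 hj') ((Finset.mem_range.1 hj').trans hj)]] at h2
  have h3 := add_left_cancel h2
  simpa using h3

/-! ### Monomial symmetric functions of the three shapes -/

/-- The parts are the exponents of the monomial `s`, so their number is the number of distinct
variables, which suffices for these shapes. -/
theorem ofSym_eq_iff {n : ℕ} {lam : n.Partition}
    (hlam : lam.parts = {n} ∨ lam.parts = Multiset.replicate n 1 ∨
      lam.parts = 2 ::ₘ Multiset.replicate (n - 2) 1) (s : Sym (Fin n) n) :
    Nat.Partition.ofSym s = lam ↔ (s : Multiset (Fin n)).toFinset.card = lam.parts.card := by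
  have hcard : (Nat.Partition.ofSym s).parts.card = (s : Multiset (Fin n)).toFinset.card := by
    simp [Nat.Partition.ofSym, Multiset.toFinset]
  constructor
  · rintro rfl
    exact hcard.symm
  · intro h
    exact Nat.Partition.ext (eq_parts_of_card_eq hlam (fun _ => Nat.Partition.parts_pos _)
      (Nat.Partition.parts_sum _) (hcard.trans h))

theorem msymm_eq_sum_filter {n : ℕ} {lam : n.Partition}
    (hlam : lam.parts = {n} ∨ lam.parts = Multiset.replicate n 1 ∨
      lam.parts = 2 ::ₘ Multiset.replicate (n - 2) 1) :
    MvPolynomial.msymm (Fin n) ℚ lam =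
      ∑ s ∈ Finset.univ.filter fun s : Sym (Fin n) n =>
        (s : Multiset (Fin n)).toFinset.card = lam.parts.card, ((s : Multiset (Fin n)).map MvPolynomial.X).prod := by
  symm
  exact Finset.sum_subtype (p := fun s => Nat.Partition.ofSym s = lam) _
    (fun s => by rw [Finset.mem_filter_univ, ofSym_eq_iff hlam])
    (fun s : Sym (Fin n) n => ((s : Multiset (Fin n)).map MvPolynomial.X).prod)

theorem msymm_eq_psum {n : ℕ} (hn : 1 ≤ n) {lam : n.Partition} (hlam : lam.parts = {n}) :
    MvPolynomial.msymm (Fin n) ℚ lam = MvPolynomial.psum (Fin n) ℚ n := by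
  rw [msymm_eq_sum_filter (Or.inl hlam), MvPolynomial.psum, hlam, Multiset.card_singleton]
  symm
  refine Finset.sum_nbij (fun i => Sym.replicate n i) ?_ ?_ ?_ ?_
  · intro i _
    rw [Finset.mem_filter_univ]
    change (Multiset.replicate n i).toFinset.card = 1
    rw [Multiset.toFinset_replicate, if_neg (by omega), Finset.card_singleton]
  · intro i _ j _ h
    exact (Sym.replicate_right_inj (by omega)).1 h
  · intro s hs
    rw [Finset.mem_coe, Finset.mem_filter_univ, Finset.card_eq_one] at hs
    obtain ⟨i, hi⟩ := hs
    refine ⟨i, Finset.mem_coe.2 (Finset.mem_univ _), Sym.coe_injective ?_⟩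
    symm
    refine Multiset.eq_replicate.2 ⟨s.card_coe, fun b hb => ?_⟩
    rw [← Multiset.mem_toFinset, hi, Finset.mem_singleton] at hb
    exact hb
  · intro i _
    change _ = ((Multiset.replicate n i).map MvPolynomial.X).prod
    simp

theorem msymm_eq_esymm {n : ℕ} {lam : n.Partition} (hlam : lam.parts = Multiset.replicate n 1) :
    MvPolynomial.msymm (Fin n) ℚ lam = MvPolynomial.esymm (Fin n) ℚ n := by
  rw [msymm_eq_sum_filter (Or.inr (Or.inl hlam)), MvPolynomial.esymm, powersetCard_self_univ, Finset.sum_singleton,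
    hlam, Multiset.card_replicate]
  have hfilter : (Finset.univ.filter fun s : Sym (Fin n) n => (s : Multiset (Fin n)).toFinset.card = n) =
      {Sym.mk (Finset.univ : Finset (Fin n)).val (by simp)} := by
    ext s
    rw [Finset.mem_filter_univ, Finset.mem_singleton]
    constructor
    · intro h
      refine Sym.coe_injective (Multiset.eq_of_le_of_card_le ?_ ?_).symm
      · have : (s : Multiset (Fin n)).toFinset = Finset.univ := by rw [← Finset.card_eq_iff_eq_univ, h]; simp
        rw [Sym.coe_mk, ← this]
        exact Multiset.dedup_le _
      · rw [Sym.card_coe]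
        simp
    · rintro rfl
      simp
  rw [hfilter, Finset.sum_singleton]
  rfl

theorem esymm_eq_sum_compl (m : ℕ) : MvPolynomial.esymm (Fin (m + 1)) ℚ m =
    ∑ b : Fin (m + 1), ∏ i ∈ ({b}ᶜ : Finset (Fin (m + 1))), MvPolynomial.X i := by
  have h : Finset.powersetCard m (Finset.univ : Finset (Fin (m + 1))) =
      Finset.univ.map ⟨fun b => ({b}ᶜ : Finset (Fin (m + 1))),
        compl_injective.comp Finset.singleton_injective⟩ := by
    rw [← filter_card_eq_map_compl]
    ext A
    simp
  rw [MvPolynomial.esymm, h, Finset.sum_map]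
  rfl

/-- Expand `p_1 e_m` over pairs `(a, b)` as `x_a ∏_{i ≠ b} x_i`. The diagonal gives `m + 1` copies
of `e_(m+1)`; a pair with `a ≠ b` gives the monomial with `x_a` squared and `x_b` missing, and
determines it uniquely. -/
theorem msymm_eq_psum_mul_esymm_sub {m : ℕ} {lam : (m + 1).Partition}
    (hlam : lam.parts = 2 ::ₘ Multiset.replicate (m - 1) 1) (hm : 1 ≤ m) :
    MvPolynomial.msymm (Fin (m + 1)) ℚ lam =
      MvPolynomial.psum (Fin (m + 1)) ℚ 1 * MvPolynomial.esymm (Fin (m + 1)) ℚ m -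
        (m + 1 : ℕ) * MvPolynomial.esymm (Fin (m + 1)) ℚ (m + 1) := by
  have hcard : lam.parts.card = m := by
    rw [hlam, Multiset.card_cons, Multiset.card_replicate]
    omega
  have hdiag : ((m + 1 : ℕ) : MvPolynomial (Fin (m + 1)) ℚ) *
      MvPolynomial.esymm (Fin (m + 1)) ℚ (m + 1) =
        ∑ x : Fin (m + 1) × Fin (m + 1) with ¬ x.1 ≠ x.2,
          MvPolynomial.X x.1 * ∏ i ∈ ({x.2}ᶜ : Finset (Fin (m + 1))), MvPolynomial.X i := by
    rw [MvPolynomial.esymm, powersetCard_self_univ, Finset.sum_singleton]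
    have : (Finset.univ.filter fun x : Fin (m + 1) × Fin (m + 1) => ¬ x.1 ≠ x.2) =
        Finset.univ.map (Function.Embedding.mk (fun a => (a, a)) fun a b h => congrArg Prod.fst h) := by
      ext ⟨a, b⟩
      simp only [Finset.mem_filter_univ, not_not, Finset.mem_map, Finset.mem_univ, true_and]
      exact ⟨fun h => ⟨a, Prod.ext rfl h⟩, fun ⟨c, h⟩ => by cases h; rfl⟩
    rw [this, Finset.sum_map]
    change _ = ∑ a : Fin (m + 1), MvPolynomial.X a * ∏ i ∈ ({a}ᶜ : Finset _), MvPolynomial.X i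
    rw [Finset.sum_congr rfl fun a _ => (Fintype.prod_eq_mul_prod_compl a _).symm]
    simp
  rw [hdiag, MvPolynomial.psum_one, esymm_eq_sum_compl, Finset.sum_mul_sum, ← Finset.sum_product',
    Finset.univ_product_univ,
    ← Finset.sum_filter_add_sum_filter_not Finset.univ
      (fun x : Fin (m + 1) × Fin (m + 1) => x.1 ≠ x.2), add_sub_cancel_right,
    msymm_eq_sum_filter (Or.inr (Or.inr hlam)), hcard]
  have htoFinset {a b : Fin (m + 1)} (hab : a ≠ b) :
      (a ::ₘ ({b}ᶜ : Finset (Fin (m + 1))).val).toFinset = {b}ᶜ := by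
    rw [Multiset.toFinset_cons, Finset.val_toFinset, Finset.insert_eq_self]
    simpa using hab
  symm
  refine Finset.sum_nbij
    (fun x => Sym.mk (x.1 ::ₘ ({x.2}ᶜ : Finset (Fin (m + 1))).val)
      (by rw [Multiset.card_cons, Finset.card_val, Finset.card_compl]; simp)) ?_ ?_ ?_ ?_
  · rintro ⟨a, b⟩ hab
    rw [Finset.mem_filter_univ] at hab ⊢
    rw [Sym.coe_mk, htoFinset hab, Finset.card_compl]
    simp
  · rintro ⟨a, b⟩ hab ⟨c, d⟩ hcd h
    rw [Finset.mem_coe, Finset.mem_filter_univ] at hab hcd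
    have h' : a ::ₘ ({b}ᶜ : Finset (Fin (m + 1))).val = c ::ₘ ({d}ᶜ : Finset (Fin (m + 1))).val :=
      congrArg Sym.toMultiset h
    have hbd := congrArg Multiset.toFinset h'
    rw [htoFinset hab, htoFinset hcd, compl_inj_iff, Finset.singleton_inj] at hbd
    subst hbd
    rw [(Multiset.cons_inj_left _).1 h']
  · intro s hs
    rw [Finset.mem_coe, Finset.mem_filter_univ] at hs
    have hc : (s : Multiset (Fin (m + 1))).toFinsetᶜ.card = 1 := by
      rw [Finset.card_compl, hs]
      simp
    obtain ⟨b, hb⟩ := Finset.card_eq_one.1 hc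
    rw [compl_eq_comm] at hb
    -- `s` has `m + 1` letters, `m` of them distinct: the surplus `t` over the support is the single
    -- repeated letter `a`.
    obtain ⟨t, ht⟩ := Multiset.le_iff_exists_add.1 (Multiset.dedup_le (s : Multiset (Fin (m + 1))))
    rw [← Multiset.toFinset_val, ← hb] at ht
    have htc : t.card = 1 := by
      have := congrArg Multiset.card ht
      rw [Sym.card_coe, Multiset.card_add, Finset.card_val, Finset.card_compl] at this
      simp at this
      omega
    obtain ⟨a, rfl⟩ := Multiset.card_eq_one.1 htc
    have ha : a ∈ (s : Multiset (Fin (m + 1))).toFinset := by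
      rw [Multiset.mem_toFinset, ht]
      simp
    refine ⟨(a, b), ?_, Sym.coe_injective ?_⟩
    · rw [Finset.mem_coe, Finset.mem_filter_univ]
      rw [← hb] at ha
      simpa using ha
    · rw [Sym.coe_mk, ht, ← Multiset.singleton_add]
      exact add_comm _ _
  · rintro ⟨a, b⟩ _
    change _ = ((a ::ₘ ({b}ᶜ : Finset (Fin (m + 1))).val).map MvPolynomial.X).prod
    rw [Multiset.map_cons, Multiset.prod_cons]
    rfl

/-! ### The numerical invariants of the three shapes -/

/-- The offset `c` absorbs the index shift of `mapIdx_cons` in the induction. -/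
theorem List.sum_mapIdx_replicate_one (k c : ℕ) :
    ((List.replicate k 1).mapIdx fun i a => (i + c) * a).sum = k.choose 2 + k * c := by
  induction k generalizing c with
  | zero => simp
  | succ k ih =>
    rw [List.replicate_succ, List.mapIdx_cons, List.sum_cons]
    simp_rw [add_assoc, ih]
    rw [Nat.choose_succ_succ' k 1, Nat.choose_one_right]
    ring

theorem Multiset.sort_replicate_one (k : ℕ) :
    (Multiset.replicate k 1).sort (· ≥ ·) = List.replicate k 1 :=
  List.eq_replicate_iff.2 ⟨by simp, fun b hb => Multiset.eq_of_mem_replicate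
    ((Multiset.mem_sort _).1 hb)⟩

theorem partitionWeight_singleton {n : ℕ} {lam : n.Partition} (hlam : lam.parts = {n}) :
    partitionWeight lam = 0 := by
  simp [partitionWeight, hlam]

theorem partitionWeight_replicate {n : ℕ} {lam : n.Partition}
    (hlam : lam.parts = Multiset.replicate n 1) : partitionWeight lam = n.choose 2 := by
  rw [partitionWeight, hlam, Multiset.sort_replicate_one]
  exact List.sum_mapIdx_replicate_one n 0

theorem partitionWeight_cons {k : ℕ} {n : ℕ} {lam : n.Partition}
    (hlam : lam.parts = 2 ::ₘ Multiset.replicate k 1) :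
    partitionWeight lam = (k + 1).choose 2 := by
  rw [partitionWeight, hlam, Multiset.sort_cons _ _ _ (by simp +contextual [Multiset.mem_replicate]),
    Multiset.sort_replicate_one, List.mapIdx_cons, List.sum_cons, List.sum_mapIdx_replicate_one,
    Nat.choose_succ_succ' k 1, Nat.choose_one_right]
  ring

theorem multFactorial_eq_prod {n : ℕ} {lam : n.Partition} {s : Finset ℕ}
    (h : ∀ i ∈ lam.parts, i ∈ s) : multFactorial lam = ∏ j ∈ s, (lam.parts.count j).factorial := by
  refine Finset.prod_subset (fun i hi => h i (Multiset.mem_toFinset.1 hi)) fun i _ hi => ?_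
  rw [Multiset.mem_toFinset] at hi
  rw [Multiset.count_eq_zero_of_notMem hi, Nat.factorial_zero]

theorem multFactorial_singleton {n : ℕ} {lam : n.Partition} (hlam : lam.parts = {n}) :
    multFactorial lam = 1 := by
  simp [multFactorial, hlam]

theorem multFactorial_replicate {n : ℕ} {lam : n.Partition}
    (hlam : lam.parts = Multiset.replicate n 1) : multFactorial lam = n.factorial := by
  rw [multFactorial_eq_prod (s := {1}) (by simp +contextual [hlam, Multiset.mem_replicate]),
    Finset.prod_singleton, hlam, Multiset.count_replicate_self]

theorem multFactorial_cons {k n : ℕ} {lam : n.Partition}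
    (hlam : lam.parts = 2 ::ₘ Multiset.replicate k 1) : multFactorial lam = k.factorial := by
  rw [multFactorial_eq_prod (s := {1, 2}) (by simp +contextual [hlam, Multiset.mem_replicate]),
    Finset.prod_pair (by decide), hlam]
  simp [Multiset.count_replicate]

/-! ### The polynomials `J_λ` and `P_λ` for the three shapes -/

/-- `monomialJ` is a Euclidean quotient, so it solves the equation only once some solution is
exhibited; the divisor is nonzero because `1 - X` takes the value `1` at `0`. -/
theorem IsMonomialJ.monomialJ_eq {n : ℕ} {lam : n.Partition} {J : ℚ[X]} (h : IsMonomialJ lam J) :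
    monomialJ lam = J := by
  rw [IsMonomialJ] at h
  rw [monomialJ, h]
  refine mul_div_cancel_left₀ J (mul_ne_zero (pow_ne_zero _ ?_) (pow_ne_zero _ X_ne_zero))
  intro h0
  simpa using congrArg (eval 0) h0

/-- `J` is `c_n(t)/t^(n-1)`, read at `t = q - 1`; the sign of the specialized `p_n` turns
`(q-1)^(n-1)` into `(1-q)^(n-1)`. -/
theorem exists_isMonomialJ_singleton {n : ℕ} (hn : 1 ≤ n) {lam : n.Partition}
    (hlam : lam.parts = {n}) : ∃ J : ℚ[X], IsMonomialJ lam (J.comp (X - 1)) ∧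
      connEnum n = X ^ (n - 1) * J := by
  obtain ⟨m, rfl⟩ := Nat.exists_eq_add_of_le' hn
  obtain ⟨J, hJ⟩ := X_pow_dvd_connEnum (m + 1)
  refine ⟨J, ?_, hJ⟩
  have hs : specializedMonomial lam =
      (-1) ^ m * C (1 / (m.factorial : ℚ)) * (connEnum (m + 1)).comp (X - 1) := by
    rw [← specialization_psum (Nat.lt_succ_self m), specializedMonomial]
    congr 1
    exact Subtype.ext (msymm_eq_psum hn hlam)
  rw [IsMonomialJ, hs, hJ, partitionWeight_singleton hlam, multFactorial_singleton hlam, hlam]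
  have hfac : C ((m.factorial : ℕ) : ℚ) * C (1 / (m.factorial : ℚ)) = 1 := by
    rw [← C_mul, mul_one_div_cancel (by positivity), C_1]
  have hpow : (1 - X : ℚ[X]) ^ m = (-1) ^ m * (X - 1) ^ m := by
    rw [← mul_pow]
    ring
  simp only [Nat.add_sub_cancel, mul_one, Multiset.card_singleton, mul_comp, pow_comp, X_comp,
    pow_zero, hpow]
  linear_combination ((-1) ^ m * (X - 1) ^ m * J.comp (X - 1)) * hfac

theorem isMonomialJ_replicate {n : ℕ} {lam : n.Partition}
    (hlam : lam.parts = Multiset.replicate n 1) :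
    IsMonomialJ lam (C ((n - 1).factorial : ℚ)) := by
  have hs : specializedMonomial lam = C (1 / (n.factorial : ℚ)) * X ^ n.choose 2 := by
    rw [← specialization_esymm le_rfl, specializedMonomial]
    congr 1
    exact Subtype.ext (msymm_eq_esymm hlam)
  rw [IsMonomialJ, hs, partitionWeight_replicate hlam, multFactorial_replicate hlam, hlam,
    Multiset.card_replicate, Nat.sub_self, pow_zero, one_mul, ← mul_assoc, ← C_mul, mul_comm]
  congr 2
  push_cast
  field_simp

/-- `p_1 = e_1` goes to `1`, and `(m+1) e_(m+1)` to `q^m` times the image of `e_m`, since `(m+1)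
choose 2 = m + (m choose 2)`. -/
theorem specializedMonomial_cons {m : ℕ} (hm : 1 ≤ m) {lam : (m + 1).Partition}
    (hlam : lam.parts = 2 ::ₘ Multiset.replicate (m - 1) 1) :
    specializedMonomial lam =
      C (1 / (m.factorial : ℚ)) * X ^ m.choose 2 * (1 - X ^ m) := by
  have hp : specialization (m + 1) ⟨MvPolynomial.psum (Fin (m + 1)) ℚ 1,
      MvPolynomial.psum_isSymmetric _ _ 1⟩ = 1 := by
    have h1 := specialization_esymm (n := m + 1) (k := 1) (by omega)
    simp only [Nat.factorial_one, Nat.cast_one, div_one, C_1, one_mul] at h1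
    rw [show Nat.choose 1 2 = 0 from rfl, pow_zero] at h1
    rw [← h1]
    exact specialization_mk_congr _ _ (by rw [MvPolynomial.psum_one, MvPolynomial.esymm_one])
  have hs : (⟨MvPolynomial.msymm (Fin (m + 1)) ℚ lam, MvPolynomial.msymm_isSymmetric _ _ lam⟩ :
      MvPolynomial.symmetricSubalgebra (Fin (m + 1)) ℚ) =
      ⟨MvPolynomial.psum (Fin (m + 1)) ℚ 1, MvPolynomial.psum_isSymmetric _ _ 1⟩ *
        ⟨MvPolynomial.esymm (Fin (m + 1)) ℚ m, MvPolynomial.esymm_isSymmetric _ _ m⟩ -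
      ((m + 1 : ℕ) : MvPolynomial.symmetricSubalgebra (Fin (m + 1)) ℚ) *
        ⟨MvPolynomial.esymm (Fin (m + 1)) ℚ (m + 1),
          MvPolynomial.esymm_isSymmetric _ _ (m + 1)⟩ :=
    Subtype.ext (msymm_eq_psum_mul_esymm_sub hlam hm)
  have hfac : ((m + 1 : ℕ) : ℚ[X]) * C (1 / ((m + 1).factorial : ℚ)) =
      C (1 / (m.factorial : ℚ)) := by
    rw [← Polynomial.C_eq_natCast, ← C_mul, Nat.factorial_succ]
    congr 1
    push_cast
    field_simp
  rw [specializedMonomial, hs, map_sub, map_mul, map_mul, map_natCast, hp,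
    specialization_esymm (Nat.le_succ m), specialization_esymm le_rfl,
    Nat.choose_succ_succ' m 1, Nat.choose_one_right, pow_add]
  linear_combination (-(X ^ m * X ^ m.choose 2)) * hfac

theorem isMonomialJ_cons {m : ℕ} (hm : 1 ≤ m) {lam : (m + 1).Partition}
    (hlam : lam.parts = 2 ::ₘ Multiset.replicate (m - 1) 1) :
    IsMonomialJ lam (C ((m - 1).factorial : ℚ) * ∑ i ∈ Finset.range m, X ^ i) := by
  have hcard : m + 1 - lam.parts.card = 1 := by
    rw [hlam, Multiset.card_cons, Multiset.card_replicate]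
    omega
  have hfac : C (((m.factorial * (m - 1).factorial : ℕ) : ℚ)) * C (1 / (m.factorial : ℚ)) =
      C ((m - 1).factorial : ℚ) := by
    rw [← C_mul]
    congr 1
    push_cast
    field_simp
  have hgeom : (1 - X : ℚ[X]) * ∑ i ∈ Finset.range m, X ^ i = 1 - X ^ m :=
    mul_neg_geom_sum X m
  rw [IsMonomialJ, specializedMonomial_cons hm hlam, partitionWeight_cons hlam,
    multFactorial_cons hlam, hcard, pow_one, Nat.sub_add_cancel hm, Nat.add_sub_cancel]
  linear_combination (X ^ m.choose 2 * (1 - X ^ m)) * hfac -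
    (C ((m - 1).factorial : ℚ) * X ^ m.choose 2) * hgeom

theorem isMonomialJ_polyP_singleton {n : ℕ} (hn : 1 ≤ n) {lam : n.Partition}
    (hlam : lam.parts = {n}) : IsMonomialJ lam (monomialJ lam) ∧
      polyP lam = edgeEnumerator (rootDegreeGraphs n 1) := by
  obtain ⟨J, hJ, hc⟩ := exists_isMonomialJ_singleton hn hlam
  refine ⟨hJ.monomialJ_eq.symm ▸ hJ, ?_⟩
  rw [polyP, hJ.monomialJ_eq, partitionWeight_singleton hlam, multFactorial_singleton hlam,
    edgeEnumerator_rootDegreeGraphs_one, hc, comp_assoc]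
  have : (X - 1 : ℚ[X]).comp (1 + X) = X := by simp
  rw [this, comp_X]
  obtain ⟨m, rfl⟩ := Nat.exists_eq_add_of_le' hn
  simp only [Nat.cast_one, div_one, pow_zero, mul_one, Nat.add_sub_cancel, C_eq_natCast]
  ring

theorem isMonomialJ_polyP_replicate {n : ℕ} (hn : 1 ≤ n) {lam : n.Partition}
    (hlam : lam.parts = Multiset.replicate n 1) : IsMonomialJ lam (monomialJ lam) ∧
      polyP lam = edgeEnumerator (rootDegreeGraphs n n) := by
  have hJ := isMonomialJ_replicate hlam
  refine ⟨hJ.monomialJ_eq.symm ▸ hJ, ?_⟩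
  rw [polyP, hJ.monomialJ_eq, partitionWeight_replicate hlam, multFactorial_replicate hlam,
    edgeEnumerator_rootDegreeGraphs_self, C_comp]
  have hfac : C ((n : ℚ) / (n.factorial : ℚ)) * C ((n - 1).factorial : ℚ) = 1 := by
    rw [← C_mul, ← C_1]
    congr 1
    rw [← Nat.mul_factorial_pred (by omega : n ≠ 0)]
    push_cast
    have : (n : ℚ) ≠ 0 := by positivity
    field_simp
  linear_combination (X ^ n * (1 + X) ^ n.choose 2) * hfac

theorem isMonomialJ_polyP_cons {n : ℕ} (hn : 2 ≤ n) {lam : n.Partition}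
    (hlam : lam.parts = 2 ::ₘ Multiset.replicate (n - 2) 1) : IsMonomialJ lam (monomialJ lam) ∧
      polyP lam = edgeEnumerator (rootDegreeGraphs n (n - 1)) := by
  obtain ⟨m, rfl⟩ := Nat.exists_eq_add_of_le' (Nat.one_le_of_lt hn)
  have hm : 1 ≤ m := Nat.le_of_succ_le_succ hn
  rw [show m + 1 - 2 = m - 1 by omega] at hlam
  have hJ := isMonomialJ_cons hm hlam
  refine ⟨hJ.monomialJ_eq.symm ▸ hJ, ?_⟩
  -- At `q = 1 + t` the geometric sum in `J` supplies the factor `(1+t)^m - 1` that counts nonempty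
  -- neighbour sets, at the cost of one power of `t`.
  have hgeom : X * ∑ i ∈ Finset.range m, (1 + X : ℚ[X]) ^ i = (1 + X) ^ m - 1 := by
    rw [← mul_geom_sum (1 + X : ℚ[X]) m]
    ring
  have hfac : C (((m + 1 : ℕ) : ℚ) / ((m - 1).factorial : ℚ)) * C ((m - 1).factorial : ℚ) =
      ((m + 1 : ℕ) : ℚ[X]) := by
    rw [← C_mul, div_mul_cancel₀ _ (by positivity), C_eq_natCast]
  rw [polyP, hJ.monomialJ_eq, partitionWeight_cons hlam, multFactorial_cons hlam,
    Nat.add_sub_cancel, Nat.sub_add_cancel hm, edgeEnumerator_rootDegreeGraphs_succ, mul_comp,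
    C_comp, sum_comp]
  simp only [pow_comp, X_comp]
  rw [← hgeom]
  linear_combination (X ^ (m + 1) * (1 + X) ^ m.choose 2 *
    ∑ i ∈ Finset.range m, (1 + X : ℚ[X]) ^ i) * hfac

end

/-! ### Both sides combined for the three shapes -/

theorem mainTheorem2 (n : ℕ) (hn : 1 ≤ n) (lam : n.Partition) :
    (lam.parts = {n} ∨ lam.parts = Multiset.replicate n 1 ∨
        lam.parts = 2 ::ₘ Multiset.replicate (n - 2) 1 →
      IsMonomialJ lam (monomialJ lam) ∧ polyP lam = edgeEnumerator (dfsGraphs lam)) ∧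
    (lam.parts = {n} → dfsGraphs lam = rootDegreeGraphs n 1) ∧
    (lam.parts = Multiset.replicate n 1 → dfsGraphs lam = rootDegreeGraphs n n) ∧
    (lam.parts = 2 ::ₘ Multiset.replicate (n - 2) 1 →
      dfsGraphs lam = rootDegreeGraphs n (n - 1)) := by
  have h1 (h : lam.parts = {n}) : dfsGraphs lam = rootDegreeGraphs n 1 := by
    rw [dfsGraphs_eq_rootDegreeGraphs hn (Or.inl h), h, Multiset.card_singleton]
  have h2 (h : lam.parts = Multiset.replicate n 1) : dfsGraphs lam = rootDegreeGraphs n n := by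
    rw [dfsGraphs_eq_rootDegreeGraphs hn (Or.inr (Or.inl h)), h, Multiset.card_replicate]
  -- For `n = 1` the truncated `n - 2` would give the multiset `{2}`, whose sum is not `1`.
  have hn2 (h : lam.parts = 2 ::ₘ Multiset.replicate (n - 2) 1) : 2 ≤ n := by
    have := lam.parts_sum
    rw [h, Multiset.sum_cons] at this
    omega
  have h3 (h : lam.parts = 2 ::ₘ Multiset.replicate (n - 2) 1) :
      dfsGraphs lam = rootDegreeGraphs n (n - 1) := by
    rw [dfsGraphs_eq_rootDegreeGraphs hn (Or.inr (Or.inr h)), h, Multiset.card_cons,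
      Multiset.card_replicate, show n - 2 + 1 = n - 1 by have := hn2 h; omega]
  refine ⟨?_, h1, h2, h3⟩
  rintro (h | h | h)
  · rw [h1 h]
    exact isMonomialJ_polyP_singleton hn h
  · rw [h2 h]
    exact isMonomialJ_polyP_replicate hn h
  · rw [h3 h]
    exact isMonomialJ_polyP_cons (hn2 h) h
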